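/- Let $\mathbb F$ be $\mathbb R$ or $\mathbb C$. The split interval (double arrow space) $\ddot{\mathbb I}$ is the set $[0,1]\times\{0,1\}$ with the order topology of the lexicographic order, in which $(x,i)\le(y,j)$ if and only if $x<y$, or $x=y$ and $i\le j$; it is compact. Let $C(\ddot{\mathbb I})$ be the Banach space of continuous functions $\ddot{\mathbb I}\to\mathbb F$ with the supremum norm. A bounded subset $B$ of a Banach space $E$ over $\mathbb F$ is called \emph{limited} if $\lim_{n}\sup_{x\in B}|\chi_n(x)|=0$ for every weak$^*$ null sequence $(\chi_n)$ in the dual space $E'$. The space $E$ is \emph{Gelfand–Phillips} if every limited set in $E$ has compact closure. The space $E$ has the \emph{separable $c_0$-extension property} if every continuous linear operator $T:X\to c_0$ defined on a separable closed linear subspace $X\subseteq E$ can be extended to a continuous linear operator $\bar T:E\to c_0$, where $c_0$ is the Banach space of sequences in $\mathbb F$ that converge to $0$, with the supremum norm. Then the Banach space $C(\ddot{\mathbb I})$ is Gelfand–Phillips, but it does not have the separable $c_0$-extension property. -/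

import Mathlib

open Filter Topology
open scoped ZeroAtInfty

/-- The split interval (double arrow space): the set `[0,1] × {0,1}`, with the lexicographic order
and the order topology. -/
def SplitInterval : Type := Lex (Set.Icc (0 : ℝ) 1 × Fin 2)

namespace SplitInterval

noncomputable instance : LinearOrder SplitInterval :=
  inferInstanceAs (LinearOrder (Lex (Set.Icc (0 : ℝ) 1 × Fin 2)))

/-- The topology generated by the open rays of the lexicographic order. -/
noncomputable instance : TopologicalSpace SplitInterval := Preorder.topology SplitInterval

instance : OrderTopology SplitInterval := ⟨rfl⟩

/-- The point `(x, i)` of the split interval. -/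
def mk (x : Set.Icc (0 : ℝ) 1) (i : Fin 2) : SplitInterval := toLex (x, i)

theorem mk_le_mk {x y : Set.Icc (0 : ℝ) 1} {i j : Fin 2} :
    mk x i ≤ mk y j ↔ x < y ∨ (x = y ∧ i ≤ j) :=
  Prod.Lex.toLex_le_toLex

theorem exists_eq_mk (p : SplitInterval) : ∃ x i, p = mk x i :=
  ⟨(ofLex p).1, (ofLex p).2, rfl⟩

theorem exists_isLUB (S : Set SplitInterval) : ∃ p, IsLUB S p := by
  classical
  let A : Set (Set.Icc (0 : ℝ) 1) := {x | ∃ i, mk x i ∈ S}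
  have hA : IsLUB A (sSup A) := isLUB_sSup A
  by_cases h1 : mk (sSup A) 1 ∈ S
  · refine ⟨mk (sSup A) 1, ?_, fun q hq => hq h1⟩
    intro q hq
    obtain ⟨x, i, rfl⟩ := exists_eq_mk q
    rw [mk_le_mk]
    rcases (hA.1 (show x ∈ A from ⟨i, hq⟩)).lt_or_eq with h | h
    · exact Or.inl h
    · exact Or.inr ⟨h, by omega⟩
  · refine ⟨mk (sSup A) 0, ?_, ?_⟩
    · intro q hq
      obtain ⟨x, i, rfl⟩ := exists_eq_mk q
      rw [mk_le_mk]
      rcases (hA.1 (show x ∈ A from ⟨i, hq⟩)).lt_or_eq with h | h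
      · exact Or.inl h
      · refine Or.inr ⟨h, ?_⟩
        have hi : i ≠ 1 := by
          rintro rfl
          exact h1 (h ▸ hq)
        omega
    · intro q hq
      obtain ⟨y, j, rfl⟩ := exists_eq_mk q
      have hy : sSup A ≤ y := by
        refine hA.2 ?_
        rintro x ⟨i, hi⟩
        rcases mk_le_mk.1 (hq hi) with h | h
        · exact h.le
        · exact h.1.le
      rw [mk_le_mk]
      rcases hy.lt_or_eq with h | h
      · exact Or.inl h
      · exact Or.inr ⟨h, by omega⟩

instance : CompactSpace SplitInterval := by
  classical
  choose s hs using exists_isLUB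
  let _ : SupSet SplitInterval := ⟨s⟩
  let _ : CompleteLattice SplitInterval :=
    { completeLatticeOfSup SplitInterval hs with
      sup := max
      inf := min
      le_sup_left := le_max_left
      le_sup_right := le_max_right
      sup_le := fun _ _ _ => max_le
      inf_le_left := min_le_left
      inf_le_right := min_le_right
      le_inf := fun _ _ _ => le_min }
  let _ : ConditionallyCompleteLinearOrder SplitInterval :=
    { (inferInstance : LinearOrder SplitInterval),
      (inferInstance : ConditionallyCompleteLattice SplitInterval) with
      csSup_of_not_bddAbove := fun S hS => absurd (OrderTop.bddAbove S) hS
      csInf_of_not_bddBelow := fun S hS => absurd (OrderBot.bddBelow S) hS }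
  refine ⟨?_⟩
  have h : IsCompact (Set.Icc (⊥ : SplitInterval) ⊤) :=
    ConditionallyCompleteLinearOrder.isCompact_Icc _ _
  rwa [Set.Icc_bot_top] at h

end SplitInterval

section BanachSpaceProperties

variable (𝕜 : Type*) [RCLike 𝕜] {E : Type*} [NormedAddCommGroup E] [NormedSpace 𝕜 E]

/-- A set `B` in a normed space is limited if it is bounded and every weak* null sequence
`χ₀, χ₁, …` in the dual converges to `0` uniformly on `B`:
`sup {|χₙ x| : x ∈ B} → 0` as `n → ∞`. -/
def IsLimitedSet (B : Set E) : Prop :=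
  Bornology.IsBounded B ∧
    ∀ χ : ℕ → WeakDual 𝕜 E, Tendsto χ atTop (𝓝 0) →
      Tendsto (fun n => sSup ((fun x => ‖χ n x‖) '' B)) atTop (𝓝 0)

variable (E)

/-- `E` is Gelfand–Phillips if every limited set in `E` has compact closure. -/
def IsGelfandPhillips : Prop :=
  ∀ B : Set E, IsLimitedSet 𝕜 B → IsCompact (closure B)

/-- `E` has the separable `c₀`-extension property if every operator `X → c₀` on a separable closed
linear subspace `X` of `E` extends to an operator `E → c₀`. Here `c₀` is `C₀(ℕ, 𝕜)`, the space of
scalar sequences tending to `0` with the supremum norm. -/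
def HasSeparableC0ExtensionProperty : Prop :=
  ∀ X : Submodule 𝕜 E, IsClosed (X : Set E) → TopologicalSpace.SeparableSpace X →
    ∀ T : X →L[𝕜] C₀(ℕ, 𝕜), ∃ T' : E →L[𝕜] C₀(ℕ, 𝕜), ∀ x : X, T' (x : E) = T x

end BanachSpaceProperties

/-!
For the first half, point evaluations depend weak* continuously on the point, so on a limited set of
functions they converge uniformly along convergent sequences of points. Over a sequential compact
space a limited set is therefore equicontinuous, and Arzelà–Ascoli applies.

For the second half, operators into `c₀` are weak* null sequences of functionals. The projection
onto `[0, 1]` embeds the separable space `C([0, 1])` into the functions on the split interval.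
Choose half-open intervals `[pₙ, qₙ)` with lengths tending to zero, each point of `[0, 1)` lying in
infinitely many of them, and let `χₙ` be the difference of the evaluations at `pₙ` and `qₙ`, a
weak* null sequence on `C([0, 1])`. Modulo `C([0, 1])`, the indicators of the initial segments
`{z | z ≤ (x, 0)}` can be made to have disjoint supports, so a functional on the split interval is
determined by its restriction to `C([0, 1])` on all but countably many of them. Hence, for most `x`,
every weak* extension of `(χₙ)` takes on the indicator belonging to `x` the value `1` whenever
`x ∈ [pₙ, qₙ)`, so it cannot be weak* null.
-/

open scoped unitInterval Uniformity

section PointEvaluation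

variable (𝕜 : Type*) [RCLike 𝕜]

/-- Evaluation at the point `t`, as an element of the dual of `C(K, 𝕜)` with its weak* topology. -/
noncomputable def pointEval {K : Type*} [TopologicalSpace K] (t : K) : WeakDual 𝕜 C(K, 𝕜) :=
  StrongDual.toWeakDual (ContinuousMap.evalCLM 𝕜 t)

theorem continuous_pointEval {K : Type*} [TopologicalSpace K] :
    Continuous (pointEval 𝕜 : K → WeakDual 𝕜 C(K, 𝕜)) :=
  WeakDual.continuous_of_continuous_eval fun f => f.continuous

theorem tendsto_pointEval_sub_pointEval {Y ι : Type*} [UniformSpace Y] [CompactSpace Y]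
    {l : Filter ι} {p q : ι → Y} (hpq : Tendsto (fun i => (p i, q i)) l (𝓤 Y)) :
    Tendsto (fun i => pointEval 𝕜 (p i) - pointEval 𝕜 (q i)) l (𝓝 0) := by
  refine tendsto_iff_forall_eval_tendsto_topDualPairing.2 fun f => ?_
  have hf : Tendsto (fun i => dist (f (p i)) (f (q i))) l (𝓝 0) :=
    tendsto_uniformity_iff_dist_tendsto_zero.1
      (Tendsto.comp (CompactSpace.uniformContinuous_of_continuous f.continuous) hpq)
  simp only [dist_eq_norm] at hf
  exact tendsto_zero_iff_norm_tendsto_zero.2 hf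

end PointEvaluation

section GelfandPhillips

variable {𝕜 : Type*} [RCLike 𝕜]

theorem IsLimitedSet.tendstoUniformlyOn {E : Type*} [NormedAddCommGroup E] [NormedSpace 𝕜 E]
    {B : Set E} (hB : IsLimitedSet 𝕜 B) {χ : ℕ → WeakDual 𝕜 E} {ψ : WeakDual 𝕜 E}
    (hχ : Tendsto χ atTop (𝓝 ψ)) : TendstoUniformlyOn (fun n x => χ n x) ψ atTop B := by
  refine Metric.tendstoUniformlyOn_iff.2 fun ε hε => ?_
  have hχψ : Tendsto (fun n => χ n - ψ) atTop (𝓝 0) := by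
    simpa only [sub_self] using hχ.sub_const ψ
  filter_upwards [(hB.2 _ hχψ).eventually_lt_const hε] with n hn x hx
  have hbdd : BddAbove ((fun x => ‖(χ n - ψ) x‖) '' B) := by
    obtain ⟨C, hC⟩ :=
      ((WeakDual.toStrongDual (χ n - ψ)).lipschitz.isBounded_image hB.1).exists_norm_le
    exact ⟨C, by rintro _ ⟨y, hy, rfl⟩; exact hC _ ⟨y, hy, rfl⟩⟩
  calc dist (ψ x) (χ n x) = ‖(χ n - ψ) x‖ := dist_eq_norm_sub' _ _
    _ ≤ sSup ((fun x => ‖(χ n - ψ) x‖) '' B) := le_csSup hbdd ⟨x, hx, rfl⟩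
    _ < ε := hn

theorem IsLimitedSet.equicontinuous {K : Type*} [TopologicalSpace K] [CompactSpace K]
    [SequentialSpace K] {B : Set C(K, 𝕜)} (hB : IsLimitedSet 𝕜 B) :
    Equicontinuous (fun (f : B) (t : K) => (f : C(K, 𝕜)) t) := by
  refine equicontinuous_iff_continuous.2 (SeqContinuous.continuous fun s t hst => ?_)
  refine UniformFun.tendsto_iff_tendstoUniformly.2 ?_
  exact tendstoUniformlyOn_iff_tendstoUniformly_comp_coe.1
    (hB.tendstoUniformlyOn (((continuous_pointEval 𝕜).tendsto t).comp hst))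

theorem isCompact_closure_of_equicontinuous {K : Type*} [TopologicalSpace K] [CompactSpace K]
    {B : Set C(K, 𝕜)} (hB : Bornology.IsBounded B)
    (hB_equi : Equicontinuous (fun (f : B) (t : K) => (f : C(K, 𝕜)) t)) :
    IsCompact (closure B) := by
  obtain ⟨C, hC⟩ := hB.exists_norm_le
  have hemb : Topology.IsClosedEmbedding
      (ContinuousMap.toUniformOnFunIsCompact : C(K, 𝕜) → _) := by
    have : T2Space (UniformOnFun K 𝕜 {S | IsCompact S}) :=
      UniformOnFun.t2Space_of_covering
        (Set.sUnion_eq_univ_iff.2 fun t => ⟨{t}, isCompact_singleton, rfl⟩)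
    exact ContinuousMap.isUniformEmbedding_toUniformOnFunIsCompact.isClosedEmbedding
  exact ArzelaAscoli.isCompact_closure_of_isClosedEmbedding (fun _ hS => hS) hemb
    (fun S _ => hB_equi.equicontinuousOn S)
    fun _ _ t _ => ⟨Metric.closedBall 0 C, isCompact_closedBall _ _, fun f hf =>
      mem_closedBall_zero_iff.2 ((f.norm_coe_le_norm t).trans (hC f hf))⟩

theorem isGelfandPhillips_continuousMap (K : Type*) [TopologicalSpace K] [CompactSpace K]
    [SequentialSpace K] : IsGelfandPhillips 𝕜 C(K, 𝕜) :=
  fun _ hB => isCompact_closure_of_equicontinuous hB.1 hB.equicontinuous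

end GelfandPhillips

section NullSequences

variable {𝕜 : Type*} [RCLike 𝕜] {E F : Type*} [NormedAddCommGroup E] [NormedSpace 𝕜 E]
  [NormedAddCommGroup F] [NormedSpace 𝕜 F]

theorem exists_norm_apply_le_of_tendsto_weakDual [CompleteSpace F] {χ : ℕ → WeakDual 𝕜 F}
    {ψ : WeakDual 𝕜 F} (hχ : Tendsto χ atTop (𝓝 ψ)) : ∃ C, ∀ n x, ‖χ n x‖ ≤ C * ‖x‖ := by
  obtain ⟨C, hC⟩ := banach_steinhaus (g := fun n => WeakDual.toStrongDual (χ n)) fun x => by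
    obtain ⟨M, hM⟩ := (Metric.isBounded_range_of_tendsto _
      (tendsto_iff_forall_eval_tendsto_topDualPairing.1 hχ x)).exists_norm_le
    exact ⟨M, fun n => hM _ ⟨n, rfl⟩⟩
  exact ⟨C, fun n x => (WeakDual.toStrongDual (χ n)).le_of_opNorm_le (hC n) x⟩

/-- The operator `x ↦ (χ n x)ₙ` into `c₀` given by a weak* null sequence `χ` of functionals on a
Banach space. -/
noncomputable def c0Operator [CompleteSpace F] (χ : ℕ → WeakDual 𝕜 F)
    (hχ : Tendsto χ atTop (𝓝 0)) : F →L[𝕜] C₀(ℕ, 𝕜) :=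
  LinearMap.mkContinuousOfExistsBound
    { toFun x :=
        { toFun n := χ n x
          continuous_toFun := continuous_of_discreteTopology
          zero_at_infty' := cocompact_eq_atTop (α := ℕ) ▸
            tendsto_iff_forall_eval_tendsto_topDualPairing.1 hχ x }
      map_add' x y := by ext n; exact map_add (χ n) x y
      map_smul' c x := by ext n; exact map_smul (χ n) c x } <| by
    obtain ⟨C, hC⟩ := exists_norm_apply_le_of_tendsto_weakDual hχ
    refine ⟨C, fun x => ?_⟩
    rw [← ZeroAtInftyContinuousMap.norm_toBCF_eq_norm]
    exact (BoundedContinuousFunction.norm_le ((norm_nonneg _).trans (hC 0 x))).2 fun n => hC n x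

@[simp]
theorem c0Operator_apply [CompleteSpace F] (χ : ℕ → WeakDual 𝕜 F) (hχ : Tendsto χ atTop (𝓝 0))
    (x : F) (n : ℕ) : c0Operator χ hχ x n = χ n x := rfl

theorem exists_weakDual_seq_eq_apply (T : E →L[𝕜] C₀(ℕ, 𝕜)) :
    ∃ ψ : ℕ → WeakDual 𝕜 E, Tendsto ψ atTop (𝓝 0) ∧ ∀ n x, ψ n x = T x n := by
  let ψ (n : ℕ) : WeakDual 𝕜 E := StrongDual.toWeakDual <| LinearMap.mkContinuous
    { toFun x := T x n
      map_add' x y := by simp only [map_add, ZeroAtInftyContinuousMap.add_apply]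
      map_smul' c x := by
        simp only [map_smul, ZeroAtInftyContinuousMap.smul_apply, RingHom.id_apply] }
    ‖T‖ fun x => ((T x).toBCF.norm_coe_le_norm n).trans (T.le_opNorm x)
  refine ⟨ψ, tendsto_iff_forall_eval_tendsto_topDualPairing.2 fun x => ?_, fun _ _ => rfl⟩
  exact cocompact_eq_atTop (α := ℕ) ▸ (T x).zero_at_infty'

theorem HasSeparableC0ExtensionProperty.exists_weakDual_extension [CompleteSpace F]
    [TopologicalSpace.SeparableSpace F] (hE : HasSeparableC0ExtensionProperty 𝕜 E)
    (J : F →ₗᵢ[𝕜] E) {χ : ℕ → WeakDual 𝕜 F} (hχ : Tendsto χ atTop (𝓝 0)) :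
    ∃ ψ : ℕ → WeakDual 𝕜 E, Tendsto ψ atTop (𝓝 0) ∧ ∀ n x, ψ n (J x) = χ n x := by
  have hclosed : IsClosed (LinearMap.range J.toLinearMap : Set E) := by
    rw [LinearMap.coe_range]
    exact J.isometry.isClosedEmbedding.isClosed_range
  have hsep : TopologicalSpace.SeparableSpace (LinearMap.range J.toLinearMap) :=
    J.equivRange.surjective.denseRange.separableSpace J.equivRange.continuous
  obtain ⟨T, hT⟩ := hE _ hclosed hsep
    (c0Operator χ hχ ∘L (J.equivRange.symm : LinearMap.range J.toLinearMap →L[𝕜] F))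
  obtain ⟨ψ, hψ, hψT⟩ := exists_weakDual_seq_eq_apply T
  refine ⟨ψ, hψ, fun n x => ?_⟩
  have hx : T (J x) = c0Operator χ hχ x := by
    simpa using hT (J.equivRange x)
  rw [hψT, hx, c0Operator_apply]

end NullSequences

section FiniteSums

theorem sum_norm_apply_le_of_norm_sum_smul_le {𝕜 E ι : Type*} [RCLike 𝕜]
    [NormedAddCommGroup E] [NormedSpace 𝕜 E] (φ : StrongDual 𝕜 E) {e : ι → E} {s : Finset ι} {C : ℝ}
    (he : ∀ c : ι → 𝕜, (∀ i, ‖c i‖ = 1) → ‖∑ i ∈ s, c i • e i‖ ≤ C) :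
    ∑ i ∈ s, ‖φ (e i)‖ ≤ ‖φ‖ * C := by
  choose c hc hcφ using fun i => RCLike.exists_norm_eq_mul_self (φ (e i))
  have hφ : φ (∑ i ∈ s, c i • e i) = ((∑ i ∈ s, ‖φ (e i)‖ : ℝ) : 𝕜) := by
    simp only [map_sum, map_smul, smul_eq_mul, hcφ]
  calc ∑ i ∈ s, ‖φ (e i)‖ = ‖φ (∑ i ∈ s, c i • e i)‖ := by
        rw [hφ, RCLike.norm_of_nonneg (Finset.sum_nonneg fun _ _ => norm_nonneg _)]
    _ ≤ ‖φ‖ * C := φ.le_opNorm_of_le (he c hc)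

theorem norm_sum_le_of_pairwiseDisjoint_support {K E ι : Type*} [TopologicalSpace K]
    [CompactSpace K] [NormedAddCommGroup E] {f : ι → C(K, E)} {s : Finset ι} {C : ℝ}
    (hC : 0 ≤ C) (hf : ∀ i ∈ s, ‖f i‖ ≤ C)
    (hdisj : (s : Set ι).PairwiseDisjoint fun i => Function.support (f i)) :
    ‖∑ i ∈ s, f i‖ ≤ C := by
  refine (ContinuousMap.norm_le _ hC).2 fun z => ?_
  rw [ContinuousMap.sum_apply]
  by_cases hz : ∃ i ∈ s, z ∈ Function.support (f i)
  · obtain ⟨i, hi, hiz⟩ := hz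
    have hother : ∀ j ∈ s, j ≠ i → f j z = 0 := fun j hj hji =>
      Function.notMem_support.1 (Set.disjoint_right.1 (hdisj hj hi hji) hiz)
    rw [Finset.sum_eq_single_of_mem i hi hother]
    exact ((f i).norm_coe_le_norm z).trans (hf i hi)
  · push Not at hz
    rwa [Finset.sum_eq_zero fun i hi => Function.notMem_support.1 (hz i hi), norm_zero]

end FiniteSums

/-- Composition with a continuous surjection of compact spaces, as an isometric embedding of spaces
of continuous functions. -/
def compSurjective (𝕜 : Type*) [RCLike 𝕜] {K Y : Type*} [TopologicalSpace K] [CompactSpace K]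
    [TopologicalSpace Y] [CompactSpace Y] (π : C(K, Y)) (hπ : Function.Surjective π) :
    C(Y, 𝕜) →ₗᵢ[𝕜] C(K, 𝕜) where
  toLinearMap := (ContinuousMap.compRightAlgHom 𝕜 𝕜 π).toLinearMap
  norm_map' g := by
    refine le_antisymm ?_ ?_
    · exact (ContinuousMap.norm_le _ (norm_nonneg _)).2 fun z => g.norm_coe_le_norm (π z)
    · refine (ContinuousMap.norm_le _ (norm_nonneg _)).2 (hπ.forall.2 fun z => ?_)
      exact ContinuousMap.norm_coe_le_norm (ContinuousMap.compRightAlgHom 𝕜 𝕜 π g) z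

theorem firstCountableTopology_of_isClopen_separating_fibers {K Y : Type*} [TopologicalSpace K]
    [CompactSpace K] [TopologicalSpace Y] [T2Space Y] [FirstCountableTopology Y] {π : K → Y}
    (hπ : Continuous π)
    (hfib : ∀ p, ∃ U, IsClopen U ∧ p ∈ U ∧ ∀ z ∈ U, π z = π p → z = p) :
    FirstCountableTopology K := by
  refine ⟨fun p => ?_⟩
  obtain ⟨U, hU, hpU, hUp⟩ := hfib p
  have hnhds : 𝓝 p = comap π (𝓝 (π p)) ⊓ 𝓟 U := by
    refine le_antisymm (le_inf (hπ.tendsto p).le_comap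
      (le_principal_iff.2 (hU.isOpen.mem_nhds hpU))) (le_nhds_of_unique_clusterPt fun z hz => ?_)
    have hzU : z ∈ U := isClosed_iff_clusterPt.1 hU.isClosed z (hz.mono inf_le_right)
    have hπz : ClusterPt (π z) (𝓝 (π p)) :=
      (hz.mono inf_le_left).map hπ.continuousAt tendsto_comap
    exact hUp z hzU (eq_of_nhds_neBot hπz)
  rw [hnhds]
  infer_instance

theorem exists_fin_mem_Ico_div (m : ℕ) {x : ℝ} (hx : x ∈ Set.Ico 0 1) :
    ∃ k : Fin (m + 1), x ∈ Set.Ico ((k : ℝ) / (m + 1)) ((k + 1) / (m + 1)) := by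
  have hm : (0 : ℝ) < m + 1 := by positivity
  have hxm : 0 ≤ x * (m + 1) := mul_nonneg hx.1 hm.le
  refine ⟨⟨⌊x * (m + 1)⌋₊, (Nat.floor_lt hxm).2 ?_⟩, ?_, ?_⟩
  · exact_mod_cast mul_lt_of_lt_one_left hm hx.2
  · exact (div_le_iff₀ hm).2 (Nat.floor_le hxm)
  · exact (lt_div_iff₀ hm).2 (Nat.lt_floor_add_one _)

theorem exists_seq_Ico_dist_tendsto_zero_frequently_mem : ∃ p q : ℕ → I,
    Tendsto (fun n => dist (p n) (q n)) atTop (𝓝 0) ∧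
      ∀ x < 1, ∃ᶠ n in atTop, x ∈ Set.Ico (p n) (q n) := by
  -- All the intervals `[k / (m + 1), (k + 1) / (m + 1))`, enumerated in any order.
  obtain ⟨e⟩ : Nonempty (ℕ ≃ Σ m : ℕ, Fin (m + 1)) := nonempty_equiv_of_countable
  have hlt (i : Σ m : ℕ, Fin (m + 1)) : ((i.2 : ℕ) : ℝ) + 1 ≤ i.1 + 1 := by
    exact_mod_cast i.2.is_lt
  let p (i : Σ m : ℕ, Fin (m + 1)) : I := ⟨(i.2 : ℕ) / ((i.1 : ℝ) + 1),
    unitInterval.div_mem (by positivity) (by positivity) (by linarith [hlt i])⟩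
  let q (i : Σ m : ℕ, Fin (m + 1)) : I := ⟨((i.2 : ℕ) + 1) / ((i.1 : ℝ) + 1),
    unitInterval.div_mem (by positivity) (by positivity) (hlt i)⟩
  have hdist (i) : dist (p i) (q i) = 1 / ((i.1 : ℝ) + 1) := by
    rw [Subtype.dist_eq, dist_comm, Real.dist_eq, ← sub_div, add_sub_cancel_left,
      abs_of_pos (by positivity)]
  have hfst : Tendsto (fun i : Σ m : ℕ, Fin (m + 1) => i.1) cofinite atTop := by
    rw [← Nat.cofinite_eq_atTop]
    refine Tendsto.cofinite_of_finite_preimage_singleton fun m => ?_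
    refine (Set.finite_range fun k : Fin (m + 1) => (⟨m, k⟩ : Σ m : ℕ, Fin (m + 1))).subset ?_
    rintro ⟨m, k⟩ rfl
    exact ⟨k, rfl⟩
  rw [← Nat.cofinite_eq_atTop]
  refine ⟨p ∘ e, q ∘ e, ?_, fun x hx => ?_⟩
  · simp only [Function.comp_apply, hdist]
    exact (tendsto_one_div_add_atTop_nhds_zero_nat.comp hfst).comp e.injective.tendsto_cofinite
  · choose k hk using fun m => exists_fin_mem_Ico_div m (⟨x.2.1, hx⟩ : (x : ℝ) ∈ Set.Ico 0 1)
    have hmem (m : ℕ) : x ∈ Set.Ico (p ⟨m, k m⟩) (q ⟨m, k m⟩) := hk m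
    refine frequently_cofinite_iff_infinite.2 (Set.infinite_of_injective_forall_mem
      (f := fun m => e.symm ⟨m, k m⟩) (fun m n hmn => ?_) fun m => ?_)
    · exact congrArg Sigma.fst (e.symm.injective hmn)
    · simpa only [Set.mem_ofPred_eq, Function.comp_apply, Equiv.apply_symm_apply] using hmem m

namespace SplitInterval

/-- The projection of the split interval onto the unit interval. -/
def proj (z : SplitInterval) : I := (ofLex z).1

theorem proj_surjective : Function.Surjective proj := fun x => ⟨mk x 0, rfl⟩

theorem monotone_proj : Monotone proj := Prod.Lex.monotone_fst_ofLex

theorem continuous_proj : Continuous proj :=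
  monotone_proj.continuous_of_surjective proj_surjective

theorem strictMono_mk_zero : StrictMono fun x => mk x 0 :=
  fun _ _ h => Prod.Lex.toLex_lt_toLex.2 (Or.inl h)

theorem mk_zero_covBy_mk_one (x : I) : mk x 0 ⋖ mk x 1 :=
  Prod.Lex.toLex_covBy_toLex_iff.2 (Or.inl ⟨rfl, Fin.zero_lt_one, by decide⟩)

theorem isClopen_Iic_mk_zero (x : I) : IsClopen (Set.Iic (mk x 0)) :=
  ⟨isClosed_Iic, (mk_zero_covBy_mk_one x).Iio_eq ▸ isOpen_Iio⟩

instance : FirstCountableTopology SplitInterval := by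
  refine firstCountableTopology_of_isClopen_separating_fibers continuous_proj fun p => ?_
  obtain ⟨x, i, rfl⟩ := exists_eq_mk p
  obtain rfl | rfl : i = 0 ∨ i = 1 := by omega
  · refine ⟨_, isClopen_Iic_mk_zero x, Set.self_mem_Iic, fun z hz hzx => ?_⟩
    obtain ⟨y, j, rfl⟩ := exists_eq_mk z
    obtain rfl : y = x := hzx
    obtain rfl | rfl : j = 0 ∨ j = 1 := by omega
    · rfl
    · exact absurd hz (mk_zero_covBy_mk_one y).lt.not_ge
  · refine ⟨_, (isClopen_Iic_mk_zero x).compl, (mk_zero_covBy_mk_one x).lt.not_ge,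
      fun z hz hzx => ?_⟩
    obtain ⟨y, j, rfl⟩ := exists_eq_mk z
    obtain rfl : y = x := hzx
    obtain rfl | rfl : j = 0 ∨ j = 1 := by omega
    · exact absurd Set.self_mem_Iic hz
    · rfl

variable (𝕜 : Type*) [RCLike 𝕜]

/-- The indicator function of the initial segment `{z | z ≤ (x, 0)}`, continuous because the segment
is clopen. -/
noncomputable def lowerIndicator (x : I) : C(SplitInterval, 𝕜) :=
  LocallyConstant.charFn 𝕜 (isClopen_Iic_mk_zero x)

/-- The isometric embedding `g ↦ g ∘ proj` of the continuous functions on the unit interval into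
those on the split interval. -/
noncomputable def pullback : C(I, 𝕜) →ₗᵢ[𝕜] C(SplitInterval, 𝕜) :=
  compSurjective 𝕜 ⟨proj, continuous_proj⟩ proj_surjective

@[simp]
theorem pullback_apply (g : C(I, 𝕜)) (z : SplitInterval) : pullback 𝕜 g z = g (proj z) := rfl

variable {𝕜}

theorem lowerIndicator_of_le {x : I} {z : SplitInterval} (h : z ≤ mk x 0) :
    lowerIndicator 𝕜 x z = 1 :=
  Set.indicator_of_mem (s := Set.Iic (mk x 0)) h _

theorem lowerIndicator_of_lt {x : I} {z : SplitInterval} (h : mk x 0 < z) :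
    lowerIndicator 𝕜 x z = 0 :=
  Set.indicator_of_notMem (s := Set.Iic (mk x 0)) h.not_ge _

theorem exists_norm_lowerIndicator_sub_pullback_le {x : I} {U : Set I} (hU : IsOpen U)
    (hxU : x ∈ U) : ∃ g : C(I, 𝕜), ‖lowerIndicator 𝕜 x - pullback 𝕜 g‖ ≤ 1 ∧
      Function.support (lowerIndicator 𝕜 x - pullback 𝕜 g) ⊆ proj ⁻¹' U := by
  have hdisj : Disjoint (Set.Ici x \ U) (Set.Iic x) :=
    Set.disjoint_left.2 fun _ ⟨hxy, hyU⟩ hyx => hyU (le_antisymm (Set.mem_Ici.1 hxy) hyx ▸ hxU)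
  obtain ⟨f, hf0, hf1, hf⟩ :=
    exists_continuous_zero_one_of_isClosed (isClosed_Ici.sdiff hU) isClosed_Iic hdisj
  let g : C(I, 𝕜) := ⟨fun y => (f y : 𝕜), by fun_prop⟩
  have hlower {z} (hz : z ≤ mk x 0) : (lowerIndicator 𝕜 x - pullback 𝕜 g) z = 0 := by
    have hfz : f (proj z) = 1 := hf1 (monotone_proj hz)
    simp [lowerIndicator_of_le hz, g, hfz]
  have hupper {z} (hz : mk x 0 < z) :
      (lowerIndicator 𝕜 x - pullback 𝕜 g) z = -(f (proj z) : 𝕜) := by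
    simp [lowerIndicator_of_lt hz, g]
  refine ⟨g, (ContinuousMap.norm_le _ zero_le_one).2 fun z => ?_, fun z hz => ?_⟩
  · rcases le_or_gt z (mk x 0) with h | h
    · rw [hlower h, norm_zero]
      exact zero_le_one
    · rw [hupper h, norm_neg, RCLike.norm_of_nonneg (hf _).1]
      exact (hf _).2
  · by_contra hzU
    have hxz : mk x 0 < z := lt_of_not_ge fun h => hz (hlower h)
    have hfz : f (proj z) = 0 := hf0 ⟨monotone_proj hxz.le, hzU⟩
    exact hz (by rw [hupper hxz, hfz, RCLike.ofReal_zero, neg_zero])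

theorem sum_norm_apply_lowerIndicator_le {φ : StrongDual 𝕜 C(SplitInterval, 𝕜)}
    (hφ : ∀ g, φ (pullback 𝕜 g) = 0) (s : Finset I) :
    ∑ x ∈ s, ‖φ (lowerIndicator 𝕜 x)‖ ≤ ‖φ‖ := by
  obtain ⟨U, hU, hdisj⟩ := s.finite_toSet.t2_separation
  choose g hg_norm hg_supp using fun x =>
    exists_norm_lowerIndicator_sub_pullback_le (𝕜 := 𝕜) (hU x).2 (hU x).1
  let e (x : I) : C(SplitInterval, 𝕜) := lowerIndicator 𝕜 x - pullback 𝕜 (g x)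
  have he (c : I → 𝕜) (hc : ∀ x, ‖c x‖ = 1) : ‖∑ x ∈ s, c x • e x‖ ≤ 1 := by
    have hdisj_supp : (s : Set I).PairwiseDisjoint fun x => Function.support (c x • e x) :=
      fun x hx y hy hxy => ((hdisj hx hy hxy).preimage proj).mono
        ((Function.support_const_smul_subset (c x) (e x)).trans (hg_supp x))
        ((Function.support_const_smul_subset (c y) (e y)).trans (hg_supp y))
    refine norm_sum_le_of_pairwiseDisjoint_support zero_le_one (fun x _ => ?_) hdisj_supp
    rw [norm_smul, hc, one_mul]
    exact hg_norm x
  have hφe (x : I) : φ (e x) = φ (lowerIndicator 𝕜 x) := by rw [map_sub, hφ, sub_zero]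
  simpa only [hφe, mul_one] using sum_norm_apply_le_of_norm_sum_smul_le φ he

theorem countable_setOf_apply_lowerIndicator_ne {φ ψ : StrongDual 𝕜 C(SplitInterval, 𝕜)}
    (hφψ : ∀ g, φ (pullback 𝕜 g) = ψ (pullback 𝕜 g)) :
    {x | φ (lowerIndicator 𝕜 x) ≠ ψ (lowerIndicator 𝕜 x)}.Countable := by
  have hsum : Summable fun x => ‖(φ - ψ) (lowerIndicator 𝕜 x)‖ :=
    summable_of_sum_le (fun _ => norm_nonneg _)
      (sum_norm_apply_lowerIndicator_le fun g => sub_eq_zero.2 (hφψ g))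
  refine hsum.countable_support.mono fun x hx => ?_
  exact norm_ne_zero_iff.2 (sub_ne_zero.2 hx)

theorem not_hasSeparableC0ExtensionProperty :
    ¬ HasSeparableC0ExtensionProperty 𝕜 C(SplitInterval, 𝕜) := by
  intro hext
  obtain ⟨p, q, hpq, hfreq⟩ := exists_seq_Ico_dist_tendsto_zero_frequently_mem
  obtain ⟨ψ, hψ, hψ_pullback⟩ := hext.exists_weakDual_extension (pullback 𝕜)
    (tendsto_pointEval_sub_pointEval 𝕜 (tendsto_uniformity_iff_dist_tendsto_zero.2 hpq))
  let δ (n : ℕ) : WeakDual 𝕜 C(SplitInterval, 𝕜) :=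
    pointEval 𝕜 (mk (p n) 0) - pointEval 𝕜 (mk (q n) 0)
  have hcount : (⋃ n, {x | ψ n (lowerIndicator 𝕜 x) ≠ δ n (lowerIndicator 𝕜 x)}).Countable :=
    Set.countable_iUnion fun n => countable_setOf_apply_lowerIndicator_ne
      (φ := WeakDual.toStrongDual (ψ n)) (ψ := WeakDual.toStrongDual (δ n)) (hψ_pullback n)
  obtain ⟨x, hx, hx1⟩ : ∃ x : I, (∀ n, ψ n (lowerIndicator 𝕜 x) = δ n (lowerIndicator 𝕜 x)) ∧
      x < 1 := by
    obtain ⟨x, hx, hx0, hx1⟩ :=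
      ((hcount.image Subtype.val).dense_compl ℝ).exists_between zero_lt_one
    refine ⟨⟨x, hx0.le, hx1.le⟩, ?_, hx1⟩
    by_contra! h
    exact hx ⟨_, Set.mem_iUnion.2 h, rfl⟩
  have hone {n : ℕ} (hn : x ∈ Set.Ico (p n) (q n)) : ψ n (lowerIndicator 𝕜 x) = 1 := by
    have hp : mk (p n) 0 ≤ mk x 0 := strictMono_mk_zero.monotone hn.1
    have hq : mk x 0 < mk (q n) 0 := strictMono_mk_zero hn.2
    calc ψ n (lowerIndicator 𝕜 x)
      _ = lowerIndicator 𝕜 x (mk (p n) 0) - lowerIndicator 𝕜 x (mk (q n) 0) := hx n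
      _ = 1 := by rw [lowerIndicator_of_le hp, lowerIndicator_of_lt hq, sub_zero]
  have hlim : Tendsto (fun n => ψ n (lowerIndicator 𝕜 x)) atTop (𝓝 0) :=
    tendsto_iff_forall_eval_tendsto_topDualPairing.1 hψ _
  obtain ⟨n, hn, hn1⟩ :=
    ((hfreq x hx1).and_eventually (hlim.eventually_ne zero_ne_one)).exists
  exact hn1 (hone hn)

end SplitInterval

theorem mainTheorem7 (𝕜 : Type*) [RCLike 𝕜] :
    IsGelfandPhillips 𝕜 C(SplitInterval, 𝕜) ∧
      ¬ HasSeparableC0ExtensionProperty 𝕜 C(SplitInterval, 𝕜) :=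
  ⟨isGelfandPhillips_continuousMap SplitInterval,
    SplitInterval.not_hasSeparableC0ExtensionProperty⟩
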